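/- Let $(B,g)$ and $(F,\ddot g)$ be smooth surfaces (2-dimensional manifolds, $F$ non-empty) with smooth Riemannian or, more generally, pseudo-Riemannian metrics, and let $f:B\to(0,\infty)$ be a smooth function. Suppose that 1. the scalar curvature of $(B,g)$ is a multiple of $f$: $R_B=c\,f$ for some constant $c\in\mathbb R$; 2. $(F,\ddot g)$ is Einstein, $\ddot{\mathrm{Ric}}=\mu\,\ddot g$, with a constant $\mu\neq0$; 3. the warped product $B\times_f F=(B\times F,\ \bar g=g+f^2\ddot g)$ is Ricci-flat, $\overline{\mathrm{Ric}}=0$. Then $g$ is flat (its Riemann curvature tensor vanishes identically), and $f$ is an affine function on $(B,g)$, that is, for every geodesic $\gamma$ of $(B,g)$ defined on an open interval, $f(\gamma(t))=at+b$ for some constants $a,b\in\mathbb R$. -/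

import Mathlib

open Set
open scoped Manifold ContDiff

set_option maxSynthPendingDepth 3

noncomputable section

/-! ### Local pseudo-Riemannian geometry

`G : E → (E →L[ℝ] E →L[ℝ] ℝ)` is a field of bilinear forms on (an open part of) a
finite-dimensional vector space `E`; it plays the role of the coefficients `g_ij` of a metric in a
chart. Everything is written without choosing a basis of `E`. -/

namespace LocalMetric

variable {E : Type*} [NormedAddCommGroup E] [NormedSpace ℝ E]

/-- Christoffel symbols of the first kind, as a trilinear form:
`(u, v, w) ↦ ½ (∂_u G(v, w) + ∂_v G(u, w) - ∂_w G(u, v))`. -/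
def christoffelFst (G : E → (E →L[ℝ] E →L[ℝ] ℝ)) (y : E) : E →L[ℝ] E →L[ℝ] E →L[ℝ] ℝ :=
  let D : E →L[ℝ] E →L[ℝ] E →L[ℝ] ℝ := fderiv ℝ G y
  let D' : E →L[ℝ] E →L[ℝ] E →L[ℝ] ℝ :=
    (ContinuousLinearMap.flipₗᵢ ℝ E E ℝ).toContinuousLinearEquiv.toContinuousLinearMap.comp D.flip
  (1 / 2 : ℝ) • (D + D.flip - D')

theorem christoffelFst_apply (G : E → (E →L[ℝ] E →L[ℝ] ℝ)) (y u v w : E) :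
    christoffelFst G y u v w =
      1 / 2 * (fderiv ℝ G y u v w + fderiv ℝ G y v u w - fderiv ℝ G y w u v) := rfl

/-- Christoffel symbols (of the second kind) `Γ(u, v)` of the Levi-Civita connection, obtained by
raising the last index; where `G y` is nondegenerate and `E` is finite-dimensional,
`(G y).inverse` is the inverse of `v ↦ G y v`. -/
def christoffel (G : E → (E →L[ℝ] E →L[ℝ] ℝ)) (y : E) : E →L[ℝ] E →L[ℝ] E :=
  (ContinuousLinearMap.compL ℝ E (E →L[ℝ] ℝ) E (G y).inverse).comp (christoffelFst G y)

theorem christoffel_apply (G : E → (E →L[ℝ] E →L[ℝ] ℝ)) (y u v : E) :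
    christoffel G y u v = (G y).inverse (christoffelFst G y u v) := rfl

/-- Riemann curvature
`R(u, v) w = ∂_u Γ(v, w) - ∂_v Γ(u, w) + Γ(u, Γ(v, w)) - Γ(v, Γ(u, w))`. -/
def riemann (G : E → (E →L[ℝ] E →L[ℝ] ℝ)) (y : E) : E →L[ℝ] E →L[ℝ] E →L[ℝ] E :=
  fderiv ℝ (christoffel G) y - (fderiv ℝ (christoffel G) y).flip
    + (ContinuousLinearMap.compL ℝ E E E).bilinearComp (christoffel G y) (christoffel G y)
    - ((ContinuousLinearMap.compL ℝ E E E).bilinearComp (christoffel G y) (christoffel G y)).flip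

theorem riemann_apply (G : E → (E →L[ℝ] E →L[ℝ] ℝ)) (y u v w : E) :
    riemann G y u v w =
      fderiv ℝ (christoffel G) y u v w - fderiv ℝ (christoffel G) y v u w
        + christoffel G y u (christoffel G y v w)
        - christoffel G y v (christoffel G y u w) := rfl

variable [FiniteDimensional ℝ E]

/-- Ricci curvature `Ric(v, w) = tr (u ↦ R(u, v) w)`. -/
def ricci (G : E → (E →L[ℝ] E →L[ℝ] ℝ)) (y : E) : E →L[ℝ] E →L[ℝ] ℝ :=
  LinearMap.toContinuousLinearMap
    { toFun := fun v => LinearMap.toContinuousLinearMap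
        { toFun := fun w => LinearMap.trace ℝ E (((riemann G y).flip v).flip w : E →L[ℝ] E)
          map_add' := fun a b => by simp
          map_smul' := fun a b => by simp }
      map_add' := fun a b => by ext; simp
      map_smul' := fun a b => by ext; simp }

theorem ricci_apply (G : E → (E →L[ℝ] E →L[ℝ] ℝ)) (y v w : E) :
    ricci G y v w = LinearMap.trace ℝ E (((riemann G y).flip v).flip w : E →L[ℝ] E) := rfl

/-- Scalar curvature: the `G`-trace of the Ricci curvature. -/
def scalar (G : E → (E →L[ℝ] E →L[ℝ] ℝ)) (y : E) : ℝ :=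
  LinearMap.trace ℝ E ((G y).inverse.comp (ricci G y) : E →L[ℝ] E)

end LocalMetric

/-! ### Manifolds (without boundary) -/

section Manifold

variable {E : Type*} [NormedAddCommGroup E] [NormedSpace ℝ E]
  {H : Type*} [TopologicalSpace H] (I : ModelWithCorners ℝ E H)
  (M : Type*) [TopologicalSpace M] [ChartedSpace H M]

/-- A field of bilinear forms on the tangent spaces of `M` (a covariant 2-tensor field). -/
abbrev BilinField : Type _ :=
  ∀ x : M, TangentSpace I x →L[ℝ] TangentSpace I x →L[ℝ] ℝ

/-- A smooth pseudo-Riemannian metric on `M`: a smooth field of symmetric nondegenerate bilinear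
forms on the tangent spaces. Riemannian metrics are those that are moreover positive definite. -/
structure PseudoRiemannianMetric [IsManifold I ∞ M] where
  val : BilinField I M
  symm : ∀ (x : M) (v w : TangentSpace I x), val x v w = val x w v
  nondegenerate : ∀ (x : M) (v : TangentSpace I x), (∀ w, val x v w = 0) → v = 0
  contMDiff : ContMDiff I (I.prod 𝓘(ℝ, E →L[ℝ] E →L[ℝ] ℝ)) ∞
    (fun x => Bundle.TotalSpace.mk' (E →L[ℝ] E →L[ℝ] ℝ)
      (E := fun x : M => TangentSpace I x →L[ℝ] TangentSpace I x →L[ℝ] ℝ) x (val x))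

variable {I M}

/-- The field `g` read in the chart `φ` at `x₀`: the pullback of `g` by `φ⁻¹`, that is
`y ↦ ((u, v) ↦ g_{φ⁻¹ y} (d(φ⁻¹)_y u, d(φ⁻¹)_y v))`. -/
def BilinField.inChart (g : BilinField I M) (x₀ : M) (y : E) : E →L[ℝ] E →L[ℝ] ℝ :=
  let L : E →L[ℝ] TangentSpace I ((extChartAt I x₀).symm y) :=
    mfderivWithin 𝓘(ℝ, E) I (extChartAt I x₀).symm (range I) y
  (ContinuousLinearMap.precomp ℝ L).comp ((g ((extChartAt I x₀).symm y)).comp L)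

/-- `g` is flat: its Riemann curvature vanishes (in every chart, at every point of the chart). -/
def IsFlat (g : BilinField I M) : Prop :=
  ∀ x₀ : M, ∀ y ∈ (extChartAt I x₀).target, LocalMetric.riemann (g.inChart x₀) y = 0

/-- `Ric_g = lam • g` with the constant `lam`. For `lam = 0` this says that `g` is Ricci-flat. -/
def IsEinstein [FiniteDimensional ℝ E] (g : BilinField I M) (lam : ℝ) : Prop :=
  ∀ x₀ : M, ∀ y ∈ (extChartAt I x₀).target,
    LocalMetric.ricci (g.inChart x₀) y = lam • g.inChart x₀ y

/-- The function `S` is the scalar curvature of `g`. -/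
def IsScalarCurvature [FiniteDimensional ℝ E] (g : BilinField I M) (S : M → ℝ) : Prop :=
  ∀ x₀ : M, ∀ y ∈ (extChartAt I x₀).target,
    LocalMetric.scalar (g.inChart x₀) y = S ((extChartAt I x₀).symm y)

/-- `γ` is a smooth geodesic of `g` on the set `s` of parameters: in every chart it satisfies
`c'' + Γ(c', c') = 0`. -/
def IsGeodesicOn (g : BilinField I M) (γ : ℝ → M) (s : Set ℝ) : Prop :=
  ContMDiffOn 𝓘(ℝ, ℝ) I ∞ γ s ∧
    ∀ x₀ : M, ∀ t ∈ s, γ t ∈ (extChartAt I x₀).source →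
      deriv (deriv (fun τ => extChartAt I x₀ (γ τ))) t
        + LocalMetric.christoffel (g.inChart x₀) (extChartAt I x₀ (γ t))
            (deriv (fun τ => extChartAt I x₀ (γ τ)) t)
            (deriv (fun τ => extChartAt I x₀ (γ τ)) t) = 0

/-- `f` is an affine function on `(M, g)`: along each geodesic, defined on an open interval, it is
an affine function of the parameter. -/
def IsAffineFunction (g : BilinField I M) (f : M → ℝ) : Prop :=
  ∀ (γ : ℝ → M) (s : Set ℝ), IsOpen s → s.OrdConnected → IsGeodesicOn g γ s →
    ∃ a b : ℝ, ∀ t ∈ s, f (γ t) = a * t + b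

end Manifold

section WarpedProduct

variable {E : Type*} [NormedAddCommGroup E] [NormedSpace ℝ E]
  {H : Type*} [TopologicalSpace H] {I : ModelWithCorners ℝ E H}
  {B : Type*} [TopologicalSpace B] [ChartedSpace H B]
  {E' : Type*} [NormedAddCommGroup E'] [NormedSpace ℝ E']
  {H' : Type*} [TopologicalSpace H'] {J : ModelWithCorners ℝ E' H'}
  {F : Type*} [TopologicalSpace F] [ChartedSpace H' F]

/-- The warped product metric `π_B^* g + (f ∘ π_B)² π_F^* h` on `B × F`. -/
def warpedProduct (g : BilinField I B) (f : B → ℝ) (h : BilinField J F) :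
    BilinField (I.prod J) (B × F) := fun p =>
  let P : TangentSpace (I.prod J) p →L[ℝ] TangentSpace I p.1 := mfderiv (I.prod J) I Prod.fst p
  let Q : TangentSpace (I.prod J) p →L[ℝ] TangentSpace J p.2 := mfderiv (I.prod J) J Prod.snd p
  (ContinuousLinearMap.precomp ℝ P).comp ((g p.1).comp P)
    + (f p.1) ^ 2 • (ContinuousLinearMap.precomp ℝ Q).comp ((h p.2).comp Q)

end WarpedProduct

end

/-!
Work in a chart, with a base metric `G` on a surface, a fibre metric `H` in dimension `m` and a
warping function `φ`. On a surface `Ric G = (R / 2) G`, so with `R = c φ` the base part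
`Ric G = (m / φ) Hess φ` of the Ricci-flat equation reads `Hess φ = (c / 2m) φ² G`. Its trace turns
the fibre part into `Ric H = ((c / m) φ³ + (m - 1) |∇φ|²) H`, whose left-hand side does not depend
on the base point; differentiating the coefficient along the base, again with the formula for
`Hess φ`, gives `c (m + 2) / m φ² dφ = 0`. If `c ≠ 0`, then `φ` is locally constant and
`(c / 2m) φ² G = Hess φ = 0`, which is absurd. Hence `c = 0`, so that `Hess φ = 0`, and `R = 0`
makes the surface flat.
-/

open Filter Topology

namespace LocalMetric

section LinearAlgebra

variable {E : Type*} [AddCommGroup E] [Module ℝ E]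

theorem isAlt_apply_eq_det_smul {N : Type*} [AddCommGroup N] [Module ℝ N]
    (b : Module.Basis (Fin 2) ℝ E) {T : E →ₗ[ℝ] E →ₗ[ℝ] N} (hT : T.IsAlt) (u v : E) :
    T u v = b.det ![u, v] • T (b 0) (b 1) := by
  have hdet : b.det ![u, v] = b.repr u 0 * b.repr v 1 - b.repr v 0 * b.repr u 1 := by
    simp [Module.Basis.det_apply, Matrix.det_fin_two, Module.Basis.toMatrix_apply]
  have hswap : T (b 1) (b 0) = -T (b 0) (b 1) := (hT.neg _ _).symm
  conv_lhs => rw [← b.sum_repr u, ← b.sum_repr v]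
  simp only [Fin.sum_univ_two, map_add, map_smul, LinearMap.add_apply, LinearMap.smul_apply,
    hT.self_eq_zero, hswap, hdet]
  module

theorem exists_eq_smul_of_isAlt (hE : Module.finrank ℝ E = 2) {θ η : E →ₗ[ℝ] E →ₗ[ℝ] ℝ}
    (hθ : θ.IsAlt) (hη : η.IsAlt) (hη₀ : η ≠ 0) : ∃ k : ℝ, θ = k • η := by
  have : FiniteDimensional ℝ E := .of_finrank_eq_succ hE
  let b := Module.finBasisOfFinrankEq ℝ E hE
  have hb : η (b 0) (b 1) ≠ 0 := fun h => hη₀ <| by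
    ext u v
    simp [isAlt_apply_eq_det_smul b hη u v, h]
  refine ⟨θ (b 0) (b 1) / η (b 0) (b 1), ?_⟩
  ext u v
  simp only [isAlt_apply_eq_det_smul b hθ u v, isAlt_apply_eq_det_smul b hη u v,
    LinearMap.smul_apply, smul_eq_mul]
  field_simp

theorem trace_prod {E' : Type*} [AddCommGroup E'] [Module ℝ E'] [FiniteDimensional ℝ E]
    [FiniteDimensional ℝ E'] (T : E × E' →ₗ[ℝ] E × E') :
    LinearMap.trace ℝ (E × E') T =
      LinearMap.trace ℝ E (LinearMap.fst ℝ E E' ∘ₗ T ∘ₗ LinearMap.inl ℝ E E')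
        + LinearMap.trace ℝ E' (LinearMap.snd ℝ E E' ∘ₗ T ∘ₗ LinearMap.inr ℝ E E') := by
  have hT : T = LinearMap.inl ℝ E E' ∘ₗ (LinearMap.fst ℝ E E' ∘ₗ T)
      + LinearMap.inr ℝ E E' ∘ₗ (LinearMap.snd ℝ E E' ∘ₗ T) := by
    ext <;> simp
  conv_lhs => rw [hT]
  rw [map_add]
  exact congrArg₂ (· + ·) (LinearMap.trace_comp_comm' ..) (LinearMap.trace_comp_comm' ..)

end LinearAlgebra

section BilinearForms

variable {E : Type*} [NormedAddCommGroup E] [NormedSpace ℝ E]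

theorem isInvertible_of_nondegenerate [FiniteDimensional ℝ E] {g : E →L[ℝ] E →L[ℝ] ℝ}
    (hg : ∀ v, (∀ w, g v w = 0) → v = 0) : g.IsInvertible := by
  have hinj : Function.Injective (g : E →ₗ[ℝ] E →L[ℝ] ℝ) :=
    (injective_iff_map_eq_zero _).2 fun v hv => hg v fun w => DFunLike.congr_fun hv w
  have hrank : Module.finrank ℝ E = Module.finrank ℝ (E →L[ℝ] ℝ) :=
    Subspace.dual_finrank_eq.symm.trans LinearMap.toContinuousLinearMap.finrank_eq
  exact ⟨(LinearEquiv.ofInjectiveOfFinrankEq _ hinj hrank).toContinuousLinearEquiv, rfl⟩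

theorem eventually_isInvertible [CompleteSpace E] {N : Type*} [NormedAddCommGroup N]
    [NormedSpace ℝ N] {X : Type*} [TopologicalSpace X] {A : X → E →L[ℝ] N} {x : X}
    (hA : ContinuousAt A x) (hx : (A x).IsInvertible) : ∀ᶠ z in 𝓝 x, (A z).IsInvertible := by
  obtain ⟨e, he⟩ := hx
  exact hA.eventually (he ▸ e.nhds)

/-- The operator `u ∧ v : w ↦ g(v, w) u - g(u, w) v`, which is the curvature operator `R(u, v)` of a
metric of constant sectional curvature `1`. -/
noncomputable def wedge (g : E →L[ℝ] E →L[ℝ] ℝ) : E →L[ℝ] E →L[ℝ] E →L[ℝ] E :=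
  ((ContinuousLinearMap.smulRightL ℝ E E).comp g).flip
    - (ContinuousLinearMap.smulRightL ℝ E E).comp g

theorem wedge_apply (g : E →L[ℝ] E →L[ℝ] ℝ) (u v w : E) :
    wedge g u v w = g v w • u - g u w • v := rfl

theorem wedge_self (g : E →L[ℝ] E →L[ℝ] ℝ) (u : E) : wedge g u u = 0 := sub_self _

theorem trace_wedge [FiniteDimensional ℝ E] (g : E →L[ℝ] E →L[ℝ] ℝ) (v w : E) :
    LinearMap.trace ℝ E (((wedge g).flip v).flip w : E →L[ℝ] E) =
      (Module.finrank ℝ E - 1) * g v w := by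
  have hop : (((wedge g).flip v).flip w : E →ₗ[ℝ] E) =
      g v w • LinearMap.id - (g.flip w : E →ₗ[ℝ] ℝ).smulRight v := rfl
  rw [hop, map_sub, map_smul, LinearMap.trace_id, LinearMap.trace_smulRight, smul_eq_mul,
    ContinuousLinearMap.coe_coe, ContinuousLinearMap.flip_apply]
  ring

end BilinearForms

section Curvature

variable {E : Type*} [NormedAddCommGroup E] [NormedSpace ℝ E] {G : E → (E →L[ℝ] E →L[ℝ] ℝ)} {y : E}

theorem christoffel_congr {G' : E → (E →L[ℝ] E →L[ℝ] ℝ)} (h : G =ᶠ[𝓝 y] G') :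
    christoffel G y = christoffel G' y := by
  rw [christoffel, christoffel, christoffelFst, christoffelFst, h.eq_of_nhds, h.fderiv_eq]

theorem riemann_congr {G' : E → (E →L[ℝ] E →L[ℝ] ℝ)} (h : G =ᶠ[𝓝 y] G') :
    riemann G y = riemann G' y := by
  have hΓ : christoffel G =ᶠ[𝓝 y] christoffel G' :=
    h.eventuallyEq_nhds.mono fun _ hz => christoffel_congr hz
  rw [riemann, riemann, hΓ.fderiv_eq, hΓ.eq_of_nhds]

theorem riemann_self (G : E → (E →L[ℝ] E →L[ℝ] ℝ)) (y u : E) : riemann G y u u = 0 := by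
  ext w
  simp [riemann_apply]

variable [FiniteDimensional ℝ E]

theorem ricci_congr {G' : E → (E →L[ℝ] E →L[ℝ] ℝ)} (h : G =ᶠ[𝓝 y] G') :
    ricci G y = ricci G' y := by
  ext v w
  rw [ricci_apply, ricci_apply, riemann_congr h]

theorem ricci_of_riemann_eq_smul_wedge {k : ℝ} (h : riemann G y = k • wedge (G y)) :
    ricci G y = (k * (Module.finrank ℝ E - 1)) • G y := by
  ext v w
  have hop : (((riemann G y).flip v).flip w : E →ₗ[ℝ] E) =
      k • (((wedge (G y)).flip v).flip w : E →L[ℝ] E) := by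
    rw [h]
    rfl
  rw [ricci_apply, hop, map_smul, trace_wedge, smul_eq_mul, ← mul_assoc]
  rfl

theorem trace_inverse_comp_smul {g : E →L[ℝ] E →L[ℝ] ℝ} (hg : g.IsInvertible) (k : ℝ) :
    LinearMap.trace ℝ E (g.inverse.comp (k • g) : E →L[ℝ] E) = Module.finrank ℝ E * k := by
  rw [ContinuousLinearMap.comp_smul, hg.inverse_comp_self, ContinuousLinearMap.toLinearMap_smul,
    map_smul, ContinuousLinearMap.coe_id, LinearMap.trace_id, smul_eq_mul, mul_comm]

end Curvature

section Calculus

variable {E F₁ F₂ N : Type*} [NormedAddCommGroup E] [NormedSpace ℝ E]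
  [NormedAddCommGroup F₁] [NormedSpace ℝ F₁] [NormedAddCommGroup F₂] [NormedSpace ℝ F₂]
  [NormedAddCommGroup N] [NormedSpace ℝ N]

theorem differentiableAt_fderiv {p : E → N} {y : E} (hp : ContDiffAt ℝ 2 p y) :
    DifferentiableAt ℝ (fderiv ℝ p) y :=
  (hp.fderiv_right one_add_one_eq_two.le).differentiableAt one_ne_zero

theorem hasFDerivAt_apply_apply {A : E → F₁ →L[ℝ] F₂ →L[ℝ] N} {A' : E →L[ℝ] F₁ →L[ℝ] F₂ →L[ℝ] N}
    {y : E} (hA : HasFDerivAt A A' y) (v : F₁) (w : F₂) :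
    HasFDerivAt (fun z => A z v w) ((A'.flip v).flip w) y := by
  simpa using (hA.clm_apply (hasFDerivAt_const v y)).clm_apply (hasFDerivAt_const w y)

theorem hasFDerivAt_comp_fst {p : F₁ → N} {p' : F₁ →L[ℝ] N} {x : F₁} (hp : HasFDerivAt p p' x)
    (y : F₂) :
    HasFDerivAt (fun z : F₁ × F₂ => p z.1) (p'.comp (ContinuousLinearMap.fst ℝ F₁ F₂)) (x, y) :=
  HasFDerivAt.comp (g := p) (x, y) hp hasFDerivAt_fst

theorem hasFDerivAt_comp_snd {p : F₂ → N} {p' : F₂ →L[ℝ] N} {y : F₂} (hp : HasFDerivAt p p' y)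
    (x : F₁) :
    HasFDerivAt (fun z : F₁ × F₂ => p z.2) (p'.comp (ContinuousLinearMap.snd ℝ F₁ F₂)) (x, y) :=
  HasFDerivAt.comp (g := p) (x, y) hp hasFDerivAt_snd

end Calculus

/-- `G` is a metric near `y`: a symmetric form field of class `C²` around `y`, nondegenerate at `y`.
Nondegeneracy is required at `y` alone because it is an open condition, and `C²` is the least
regularity for which the curvature makes sense. -/
structure IsMetricAt {E : Type*} [NormedAddCommGroup E] [NormedSpace ℝ E]
    (G : E → (E →L[ℝ] E →L[ℝ] ℝ)) (y : E) : Prop where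
  contDiffAt : ContDiffAt ℝ 2 G y
  symm : ∀ᶠ z in 𝓝 y, ∀ v w, G z v w = G z w v
  isInvertible : (G y).IsInvertible

namespace IsMetricAt

variable {E : Type*} [NormedAddCommGroup E] [NormedSpace ℝ E] {G : E → (E →L[ℝ] E →L[ℝ] ℝ)} {y : E}

theorem ne_zero [Nontrivial E] (hG : IsMetricAt G y) : G y ≠ 0 := fun h => by
  obtain ⟨v, hv⟩ := exists_ne (0 : E)
  exact hv (hG.isInvertible.injective (by simp [h]))

theorem eventually [CompleteSpace E] (hG : IsMetricAt G y) : ∀ᶠ z in 𝓝 y, IsMetricAt G z := by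
  filter_upwards [hG.contDiffAt.eventually (by simp), hG.symm.eventually_nhds,
    eventually_isInvertible hG.contDiffAt.continuousAt hG.isInvertible] with z h₁ h₂ h₃
  exact ⟨h₁, h₂, h₃⟩

theorem differentiableAt (hG : IsMetricAt G y) : DifferentiableAt ℝ G y :=
  hG.contDiffAt.differentiableAt two_ne_zero

theorem contDiffAt_fderiv (hG : IsMetricAt G y) : ContDiffAt ℝ 1 (fderiv ℝ G) y :=
  hG.contDiffAt.fderiv_right one_add_one_eq_two.le

theorem fderiv_symm (hG : IsMetricAt G y) (u v w : E) :
    fderiv ℝ G y u v w = fderiv ℝ G y u w v := by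
  have hvw := hasFDerivAt_apply_apply hG.differentiableAt.hasFDerivAt v w
  have hwv := hasFDerivAt_apply_apply hG.differentiableAt.hasFDerivAt w v
  have hsymm : (fun z => G z v w) =ᶠ[𝓝 y] fun z => G z w v := hG.symm.mono fun z hz => hz v w
  exact DFunLike.congr_fun (hvw.unique (hwv.congr_of_eventuallyEq hsymm)) u

theorem apply_christoffel (hG : IsMetricAt G y) (u v w : E) :
    G y (christoffel G y u v) w =
      1 / 2 * (fderiv ℝ G y u v w + fderiv ℝ G y v u w - fderiv ℝ G y w u v) := by
  rw [christoffel_apply, hG.isInvertible.self_apply_inverse, christoffelFst_apply]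

theorem fderiv_eq (hG : IsMetricAt G y) (u v w : E) :
    fderiv ℝ G y u v w = G y (christoffel G y u v) w + G y v (christoffel G y u w) := by
  rw [hG.symm.self_of_nhds v, hG.apply_christoffel, hG.apply_christoffel, hG.fderiv_symm u w v,
    hG.fderiv_symm v u w, hG.fderiv_symm w u v]
  ring

theorem contDiffAt_inverse [CompleteSpace E] (hG : IsMetricAt G y) :
    ContDiffAt ℝ 2 (fun z => (G z).inverse) y :=
  hG.isInvertible.contDiffAt_map_inverse.comp y hG.contDiffAt

theorem differentiableAt_christoffel [CompleteSpace E] (hG : IsMetricAt G y) :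
    DifferentiableAt ℝ (christoffel G) y := by
  have hD : ContDiffAt ℝ 1 (fun z => (fderiv ℝ G z).flip) y :=
    (ContinuousLinearMap.flipₗᵢ ℝ E E (E →L[ℝ] ℝ)).contDiff.contDiffAt.comp y hG.contDiffAt_fderiv
  have hFst : ContDiffAt ℝ 1 (christoffelFst G) y :=
    ((hG.contDiffAt_fderiv.add hD).sub (contDiffAt_const.clm_comp hD)).const_smul (1 / 2 : ℝ)
  have hinv : ContDiffAt ℝ 1 (fun z => (G z).inverse) y := hG.contDiffAt_inverse.of_le one_le_two
  exact (((ContinuousLinearMap.compL ℝ E (E →L[ℝ] ℝ) E).contDiff.contDiffAt.comp y hinv).clm_comp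
    hFst).differentiableAt one_ne_zero

theorem fderiv_fderiv_eq [CompleteSpace E] (hG : IsMetricAt G y) (u v w z : E) :
    fderiv ℝ (fderiv ℝ G) y u v w z =
      fderiv ℝ G y u (christoffel G y v w) z + G y (fderiv ℝ (christoffel G) y u v w) z
        + fderiv ℝ G y u w (christoffel G y v z) + G y w (fderiv ℝ (christoffel G) y u v z) := by
  have hD : HasFDerivAt (fderiv ℝ G) (fderiv ℝ (fderiv ℝ G) y) y :=
    (differentiableAt_fderiv hG.contDiffAt).hasFDerivAt
  have hG' := hG.differentiableAt.hasFDerivAt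
  have hΓ := hasFDerivAt_apply_apply hG.differentiableAt_christoffel.hasFDerivAt v
  have hw := (hG'.clm_apply (hΓ w)).clm_apply (hasFDerivAt_const z y)
  have hz := (hG'.clm_apply (hasFDerivAt_const w y)).clm_apply (hΓ z)
  have heq : (fun x => fderiv ℝ G x v w z) =ᶠ[𝓝 y]
      fun x => G x (christoffel G x v w) z + G x w (christoffel G x v z) :=
    hG.eventually.mono fun x hx => hx.fderiv_eq v w z
  have h := DFunLike.congr_fun (((hasFDerivAt_apply_apply hD v w).clm_apply
    (hasFDerivAt_const z y)).unique ((hw.add hz).congr_of_eventuallyEq heq)) u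
  simp only [ContinuousLinearMap.comp_zero, zero_add, ContinuousLinearMap.flip_apply,
    ContinuousLinearMap.flip_add, add_apply, ContinuousLinearMap.comp_apply] at h
  rw [h]
  ring

theorem apply_riemann_skew [CompleteSpace E] (hG : IsMetricAt G y) (u v w z : E) :
    G y (riemann G y u v w) z = -G y (riemann G y u v z) w := by
  have hschwarz : fderiv ℝ (fderiv ℝ G) y u v = fderiv ℝ (fderiv ℝ G) y v u :=
    (hG.contDiffAt.isSymmSndFDerivAt (by simp)).eq u v
  have h := DFunLike.congr_fun (DFunLike.congr_fun hschwarz w) z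
  simp only [hG.fderiv_fderiv_eq, hG.fderiv_eq] at h
  rw [← hG.symm.self_of_nhds w]
  simp only [riemann_apply, map_add, map_sub, add_apply, sub_apply]
  rw [hG.symm.self_of_nhds (christoffel G y u w)] at h
  linear_combination h

end IsMetricAt

section Surface

variable {E : Type*} [NormedAddCommGroup E] [NormedSpace ℝ E]

theorem wedge_ne_zero {g : E →L[ℝ] E →L[ℝ] ℝ} (hg : g.IsInvertible) {u v : E}
    (huv : LinearIndependent ℝ ![u, v]) : wedge g u v ≠ 0 := fun h => by
  have hgv : g v = 0 := by
    ext w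
    have hw : g v w • u + -g u w • v = 0 := by
      simpa [wedge_apply, sub_eq_add_neg] using DFunLike.congr_fun h w
    exact (LinearIndependent.pair_iff.1 huv _ _ hw).1
  exact huv.ne_zero 1 (hg.injective (by simpa using hgv))

theorem isAlt_apply_wedge (g : E →L[ℝ] E →L[ℝ] ℝ) (u v : E) :
    (g.comp (wedge g u v)).toLinearMap₁₂.IsAlt := fun w => by
  change g (wedge g u v w) w = 0
  rw [wedge_apply, map_sub, map_smul, map_smul, sub_apply, smul_apply, smul_apply, smul_eq_mul,
    smul_eq_mul, mul_comm, sub_self]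

variable {G : E → (E →L[ℝ] E →L[ℝ] ℝ)} {y : E}

theorem IsMetricAt.isAlt_apply_riemann [CompleteSpace E] (hG : IsMetricAt G y) (u v : E) :
    ((G y).comp (riemann G y u v)).toLinearMap₁₂.IsAlt := fun w =>
  self_eq_neg.1 (hG.apply_riemann_skew u v w w)

-- Tensors alternating both in `(u, v)` and, after lowering an index, in `(w, z)` form a line when
-- `E` is a plane.
theorem IsMetricAt.exists_riemann_eq_smul_wedge (hG : IsMetricAt G y)
    (hE : Module.finrank ℝ E = 2) : ∃ k : ℝ, riemann G y = k • wedge (G y) := by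
  have : FiniteDimensional ℝ E := .of_finrank_eq_succ hE
  have : CompleteSpace E := FiniteDimensional.complete ℝ E
  let b := Module.finBasisOfFinrankEq ℝ E hE
  have hb : LinearIndependent ℝ ![b 0, b 1] := by
    convert b.linearIndependent using 1
    ext i
    fin_cases i <;> rfl
  have hwedge : ((G y).comp (wedge (G y) (b 0) (b 1))).toLinearMap₁₂ ≠ 0 := fun h =>
    wedge_ne_zero hG.isInvertible hb <| by
      ext w
      exact hG.isInvertible.injective (by ext z; simpa using LinearMap.congr_fun₂ h w z)
  obtain ⟨k, hk⟩ := exists_eq_smul_of_isAlt hE (hG.isAlt_apply_riemann (b 0) (b 1))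
    (isAlt_apply_wedge (G y) (b 0) (b 1)) hwedge
  have hk' : riemann G y (b 0) (b 1) = k • wedge (G y) (b 0) (b 1) := by
    ext w
    exact hG.isInvertible.injective (by ext z; simpa using LinearMap.congr_fun₂ hk w z)
  refine ⟨k, ContinuousLinearMap.ext fun u => ContinuousLinearMap.ext fun v => ?_⟩
  have hR : riemann G y u v = b.det ![u, v] • riemann G y (b 0) (b 1) :=
    isAlt_apply_eq_det_smul b (T := (riemann G y).toLinearMap₁₂) (riemann_self G y) u v
  have hW : wedge (G y) u v = b.det ![u, v] • wedge (G y) (b 0) (b 1) :=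
    isAlt_apply_eq_det_smul b (T := (wedge (G y)).toLinearMap₁₂) (wedge_self (G y)) u v
  rw [hR, hk', smul_apply, smul_apply, hW, smul_comm]

variable [FiniteDimensional ℝ E]

theorem IsMetricAt.riemann_eq_smul_wedge (hG : IsMetricAt G y) (hE : Module.finrank ℝ E = 2) :
    riemann G y = (scalar G y / 2) • wedge (G y) := by
  obtain ⟨k, hk⟩ := hG.exists_riemann_eq_smul_wedge hE
  have hscalar : scalar G y = 2 * k := by
    rw [scalar, ricci_of_riemann_eq_smul_wedge hk, trace_inverse_comp_smul hG.isInvertible, hE]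
    norm_num
  rw [hk, hscalar, mul_div_cancel_left₀ _ two_ne_zero]

theorem IsMetricAt.ricci_eq_smul (hG : IsMetricAt G y) (hE : Module.finrank ℝ E = 2) :
    ricci G y = (scalar G y / 2) • G y := by
  rw [ricci_of_riemann_eq_smul_wedge (hG.riemann_eq_smul_wedge hE), hE]
  norm_num

theorem IsMetricAt.riemann_eq_zero_of_scalar_eq_zero (hG : IsMetricAt G y)
    (hE : Module.finrank ℝ E = 2) (hscalar : scalar G y = 0) : riemann G y = 0 := by
  rw [hG.riemann_eq_smul_wedge hE, hscalar, zero_div, zero_smul]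

end Surface

section Gradient

variable {E : Type*} [NormedAddCommGroup E] [NormedSpace ℝ E]

/-- The gradient of `φ` with respect to `G`: the vector dual to the differential of `φ`. -/
noncomputable def grad (G : E → (E →L[ℝ] E →L[ℝ] ℝ)) (φ : E → ℝ) (y : E) : E :=
  (G y).inverse (fderiv ℝ φ y)

/-- The squared norm `G(∇φ, ∇φ)` of the gradient, in the form `dφ(∇φ)`. -/
noncomputable def gradNormSq (G : E → (E →L[ℝ] E →L[ℝ] ℝ)) (φ : E → ℝ) (y : E) : ℝ :=
  fderiv ℝ φ y (grad G φ y)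

/-- The Hessian `(u, v) ↦ ∂_u ∂_v φ - dφ(Γ(u, v))` of `φ` for the Levi-Civita connection of `G`. -/
noncomputable def hess (G : E → (E →L[ℝ] E →L[ℝ] ℝ)) (φ : E → ℝ) (y : E) : E →L[ℝ] E →L[ℝ] ℝ :=
  fderiv ℝ (fderiv ℝ φ) y
    - (ContinuousLinearMap.compL ℝ E E ℝ (fderiv ℝ φ y)).comp (christoffel G y)

/-- The Laplacian of `φ`: the `G`-trace of its Hessian. -/
noncomputable def laplacian (G : E → (E →L[ℝ] E →L[ℝ] ℝ)) (φ : E → ℝ) (y : E) : ℝ :=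
  LinearMap.trace ℝ E ((G y).inverse.comp (hess G φ y) : E →L[ℝ] E)

theorem hess_apply (G : E → (E →L[ℝ] E →L[ℝ] ℝ)) (φ : E → ℝ) (y u v : E) :
    hess G φ y u v = fderiv ℝ (fderiv ℝ φ) y u v - fderiv ℝ φ y (christoffel G y u v) := rfl

variable {G : E → (E →L[ℝ] E →L[ℝ] ℝ)} {φ : E → ℝ} {y : E}

theorem hess_eq_zero_of_fderiv_eventuallyEq_zero (h : fderiv ℝ φ =ᶠ[𝓝 y] 0) :
    hess G φ y = 0 := by
  ext u v
  simp [hess_apply, h.fderiv_eq, h.eq_of_nhds]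

theorem fderiv_inv_smul_fderiv (hφ : ContDiffAt ℝ 2 φ y) (hφ₀ : φ y ≠ 0) (u v : E) :
    fderiv ℝ (fun z => (φ z)⁻¹ • fderiv ℝ φ z) y u v =
      (φ y)⁻¹ * fderiv ℝ (fderiv ℝ φ) y u v
        - (φ y)⁻¹ * fderiv ℝ φ y u * ((φ y)⁻¹ * fderiv ℝ φ y v) := by
  have hinv : HasFDerivAt (fun z => (φ z)⁻¹) (-(φ y ^ 2)⁻¹ • fderiv ℝ φ y) y :=
    (hasDerivAt_inv hφ₀).comp_hasFDerivAt y (hφ.differentiableAt two_ne_zero).hasFDerivAt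
  rw [(hinv.fun_smul (differentiableAt_fderiv hφ).hasFDerivAt).fderiv]
  simp only [add_apply, smul_apply, ContinuousLinearMap.smulRight_apply, smul_eq_mul]
  field_simp
  ring

namespace IsMetricAt

theorem apply_grad (hG : IsMetricAt G y) (φ : E → ℝ) : G y (grad G φ y) = fderiv ℝ φ y :=
  hG.isInvertible.self_apply_inverse _

theorem laplacian_of_hess_eq_smul [FiniteDimensional ℝ E] (hG : IsMetricAt G y) {k : ℝ}
    (hk : hess G φ y = k • G y) : laplacian G φ y = Module.finrank ℝ E * k := by
  rw [laplacian, hk, trace_inverse_comp_smul hG.isInvertible]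

variable [CompleteSpace E]

theorem differentiableAt_grad (hG : IsMetricAt G y) (hφ : ContDiffAt ℝ 2 φ y) :
    DifferentiableAt ℝ (grad G φ) y :=
  (hG.contDiffAt_inverse.differentiableAt two_ne_zero).clm_apply
    (differentiableAt_fderiv hφ)

theorem apply_fderiv_grad (hG : IsMetricAt G y) (hφ : ContDiffAt ℝ 2 φ y) (u w : E) :
    G y (fderiv ℝ (grad G φ) y u) w = hess G φ y u w - G y (christoffel G y u (grad G φ y)) w := by
  have hGgrad := hG.differentiableAt.hasFDerivAt.clm_apply
    (hG.differentiableAt_grad hφ).hasFDerivAt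
  have hdφ := (differentiableAt_fderiv hφ).hasFDerivAt
  have heq : (fun z => G z (grad G φ z)) =ᶠ[𝓝 y] fderiv ℝ φ :=
    hG.eventually.mono fun z hz => hz.apply_grad φ
  have h := DFunLike.congr_fun
    (DFunLike.congr_fun (hGgrad.unique (hdφ.congr_of_eventuallyEq heq)) u) w
  have hΓ : G y (grad G φ y) (christoffel G y u w) = fderiv ℝ φ y (christoffel G y u w) := by
    rw [hG.apply_grad]
  simp only [add_apply, ContinuousLinearMap.comp_apply, ContinuousLinearMap.flip_apply,
    hG.fderiv_eq, hΓ] at h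
  rw [hess_apply]
  linear_combination h

theorem fderiv_grad (hG : IsMetricAt G y) (hφ : ContDiffAt ℝ 2 φ y) (u : E) :
    fderiv ℝ (grad G φ) y u =
      (G y).inverse (hess G φ y u) - christoffel G y u (grad G φ y) := by
  refine hG.isInvertible.injective ?_
  ext w
  rw [hG.apply_fderiv_grad hφ, map_sub, sub_apply, hG.isInvertible.self_apply_inverse]

theorem hasFDerivAt_gradNormSq (hG : IsMetricAt G y) (hφ : ContDiffAt ℝ 2 φ y) :
    HasFDerivAt (gradNormSq G φ) ((2 : ℝ) • (hess G φ y).flip (grad G φ y)) y := by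
  have hdφ := (differentiableAt_fderiv hφ).hasFDerivAt
  refine (hdφ.clm_apply (hG.differentiableAt_grad hφ).hasFDerivAt).congr_fderiv ?_
  ext u
  have h : fderiv ℝ φ y (fderiv ℝ (grad G φ) y u) =
      hess G φ y u (grad G φ y) - fderiv ℝ φ y (christoffel G y u (grad G φ y)) := by
    rw [← hG.apply_grad, hG.symm.self_of_nhds, hG.apply_fderiv_grad hφ, hG.symm.self_of_nhds,
      hG.apply_grad]
  simp only [add_apply, ContinuousLinearMap.comp_apply, h, hess_apply,
    ContinuousLinearMap.flip_apply, smul_apply, smul_eq_mul]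
  ring

theorem hasFDerivAt_gradNormSq_of_hess_eq_smul (hG : IsMetricAt G y) (hφ : ContDiffAt ℝ 2 φ y)
    {k : ℝ} (hk : hess G φ y = k • G y) :
    HasFDerivAt (gradNormSq G φ) ((2 * k) • fderiv ℝ φ y) y := by
  refine (hG.hasFDerivAt_gradNormSq hφ).congr_fderiv ?_
  ext u
  have h : G y u (grad G φ y) = fderiv ℝ φ y u := by
    rw [hG.symm.self_of_nhds, hG.apply_grad]
  simp [hk, h, mul_assoc]

end IsMetricAt

end Gradient

section Warped

variable {E : Type*} [NormedAddCommGroup E] [NormedSpace ℝ E]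
  {E' : Type*} [NormedAddCommGroup E'] [NormedSpace ℝ E']

/-- The warped product metric `G + φ² H` on a product of vector spaces; it is what `warpedProduct`
looks like in a product chart. -/
noncomputable def warped (G : E → (E →L[ℝ] E →L[ℝ] ℝ)) (φ : E → ℝ)
    (H : E' → (E' →L[ℝ] E' →L[ℝ] ℝ)) (z : E × E') : E × E' →L[ℝ] E × E' →L[ℝ] ℝ :=
  (ContinuousLinearMap.precomp ℝ (ContinuousLinearMap.fst ℝ E E')).comp
      ((G z.1).comp (ContinuousLinearMap.fst ℝ E E'))
    + (φ z.1) ^ 2 • (ContinuousLinearMap.precomp ℝ (ContinuousLinearMap.snd ℝ E E')).comp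
      ((H z.2).comp (ContinuousLinearMap.snd ℝ E E'))

theorem warped_apply (G : E → (E →L[ℝ] E →L[ℝ] ℝ)) (φ : E → ℝ) (H : E' → (E' →L[ℝ] E' →L[ℝ] ℝ))
    (z v w : E × E') : warped G φ H z v w = G z.1 v.1 w.1 + φ z.1 ^ 2 * H z.2 v.2 w.2 := rfl

variable {G : E → (E →L[ℝ] E →L[ℝ] ℝ)} {H : E' → (E' →L[ℝ] E' →L[ℝ] ℝ)} {φ : E → ℝ} {x : E} {y : E'}

theorem contDiffAt_warped (hG : ContDiffAt ℝ 2 G x) (hH : ContDiffAt ℝ 2 H y)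
    (hφ : ContDiffAt ℝ 2 φ x) : ContDiffAt ℝ 2 (warped G φ H) (x, y) := by
  have hG' : ContDiffAt ℝ 2 (fun z : E × E' => G z.1) (x, y) := hG.comp (x, y) contDiffAt_fst
  have hH' : ContDiffAt ℝ 2 (fun z : E × E' => H z.2) (x, y) := hH.comp (x, y) contDiffAt_snd
  have hφ' : ContDiffAt ℝ 2 (fun z : E × E' => φ z.1) (x, y) := hφ.comp (x, y) contDiffAt_fst
  exact (contDiffAt_const.clm_comp (hG'.clm_comp contDiffAt_const)).add
    ((hφ'.pow 2).smul (contDiffAt_const.clm_comp (hH'.clm_comp contDiffAt_const)))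

theorem fderiv_warped (hG : DifferentiableAt ℝ G x) (hH : DifferentiableAt ℝ H y)
    (hφ : DifferentiableAt ℝ φ x) (hW : DifferentiableAt ℝ (warped G φ H) (x, y))
    (u v w : E × E') :
    fderiv ℝ (warped G φ H) (x, y) u v w =
      fderiv ℝ G x u.1 v.1 w.1 + 2 * φ x * fderiv ℝ φ x u.1 * H y v.2 w.2
        + φ x ^ 2 * fderiv ℝ H y u.2 v.2 w.2 := by
  have hG' := hasFDerivAt_comp_fst (hasFDerivAt_apply_apply hG.hasFDerivAt v.1 w.1) y
  have hH' := hasFDerivAt_comp_snd (hasFDerivAt_apply_apply hH.hasFDerivAt v.2 w.2) x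
  have hφ' := hasFDerivAt_comp_fst hφ.hasFDerivAt y
  have hformula := hG'.add ((hφ'.pow 2).mul hH')
  have h := DFunLike.congr_fun ((hasFDerivAt_apply_apply hW.hasFDerivAt v w).unique hformula) u
  simp only [ContinuousLinearMap.flip_apply, ContinuousLinearMap.comp_apply,
    ContinuousLinearMap.coe_fst', ContinuousLinearMap.coe_snd', add_apply, smul_apply, smul_eq_mul,
    nsmul_eq_mul, Nat.cast_ofNat, Nat.add_one_sub_one, pow_one] at h
  rw [h]
  ring

variable [FiniteDimensional ℝ E] [FiniteDimensional ℝ E']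

theorem IsMetricAt.warped (hG : IsMetricAt G x) (hH : IsMetricAt H y) (hφ : ContDiffAt ℝ 2 φ x)
    (hφ₀ : φ x ≠ 0) : IsMetricAt (warped G φ H) (x, y) where
  contDiffAt := contDiffAt_warped hG.contDiffAt hH.contDiffAt hφ
  symm := by
    filter_upwards [hG.symm.prod_inl_nhds y, hH.symm.prod_inr_nhds x] with z hz hz' v w
    rw [warped_apply, warped_apply, hz, hz']
  isInvertible := by
    refine isInvertible_of_nondegenerate fun v hv => Prod.ext ?_ ?_
    · refine hG.isInvertible.injective ?_
      ext w
      simpa [warped_apply] using hv (w, 0)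
    · refine hH.isInvertible.injective ?_
      ext w
      simpa [warped_apply, hφ₀] using hv (0, w)

theorem christoffel_warped (hG : IsMetricAt G x) (hH : IsMetricAt H y) (hφ : ContDiffAt ℝ 2 φ x)
    (hφ₀ : φ x ≠ 0) (u v : E × E') :
    christoffel (warped G φ H) (x, y) u v =
      (christoffel G x u.1 v.1 - H y u.2 v.2 • φ x • grad G φ x,
        christoffel H y u.2 v.2 + ((φ x)⁻¹ • fderiv ℝ φ x) u.1 • v.2
          + ((φ x)⁻¹ • fderiv ℝ φ x) v.1 • u.2) := by
  have hW := hG.warped hH hφ hφ₀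
  refine hW.isInvertible.injective ?_
  refine ContinuousLinearMap.ext fun w => ?_
  rw [hW.apply_christoffel, warped_apply]
  simp only [fderiv_warped hG.differentiableAt hH.differentiableAt
      (hφ.differentiableAt two_ne_zero) hW.differentiableAt, map_sub, map_add, map_smul, sub_apply,
    add_apply, smul_apply, hG.apply_christoffel, hH.apply_christoffel, hG.apply_grad, smul_eq_mul]
  rw [hH.symm.self_of_nhds u.2 w.2, hH.symm.self_of_nhds v.2 w.2, hH.symm.self_of_nhds w.2 u.2,
    hH.symm.self_of_nhds w.2 v.2]
  field_simp
  ring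

theorem eventually_christoffel_warped (hG : IsMetricAt G x) (hH : IsMetricAt H y)
    (hφ : ContDiffAt ℝ 2 φ x) (hφ₀ : φ x ≠ 0) (u v : E × E') :
    (fun z => christoffel (warped G φ H) z u v) =ᶠ[𝓝 (x, y)] fun z =>
      (christoffel G z.1 u.1 v.1 - H z.2 u.2 v.2 • φ z.1 • grad G φ z.1,
        christoffel H z.2 u.2 v.2 + ((φ z.1)⁻¹ • fderiv ℝ φ z.1) u.1 • v.2
          + ((φ z.1)⁻¹ • fderiv ℝ φ z.1) v.1 • u.2) := by
  have := FiniteDimensional.complete ℝ E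
  have := FiniteDimensional.complete ℝ E'
  filter_upwards [hG.eventually.prod_inl_nhds y, hH.eventually.prod_inr_nhds x,
    (hφ.eventually (by simp)).prod_inl_nhds y,
    (hφ.continuousAt.eventually_ne hφ₀).prod_inl_nhds y] with z hG hH hφ hφ₀
  exact christoffel_warped hG hH hφ hφ₀ u v

theorem fderiv_christoffel_warped (hG : IsMetricAt G x) (hH : IsMetricAt H y)
    (hφ : ContDiffAt ℝ 2 φ x) (hφ₀ : φ x ≠ 0) (u v w : E × E') :
    fderiv ℝ (christoffel (warped G φ H)) (x, y) u v w =
      (fderiv ℝ (christoffel G) x u.1 v.1 w.1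
          - (H y v.2 w.2 • fderiv ℝ (φ • grad G φ) x u.1
            + fderiv ℝ H y u.2 v.2 w.2 • φ x • grad G φ x),
        fderiv ℝ (christoffel H) y u.2 v.2 w.2
          + fderiv ℝ (fun z => (φ z)⁻¹ • fderiv ℝ φ z) x u.1 v.1 • w.2
          + fderiv ℝ (fun z => (φ z)⁻¹ • fderiv ℝ φ z) x u.1 w.1 • v.2) := by
  have := FiniteDimensional.complete ℝ E
  have := FiniteDimensional.complete ℝ E'
  have hdφ := hφ.differentiableAt two_ne_zero
  have hθ : DifferentiableAt ℝ (fun z => (φ z)⁻¹ • fderiv ℝ φ z) x :=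
    (hdφ.inv hφ₀).smul (differentiableAt_fderiv hφ)
  have hΓG := hasFDerivAt_comp_fst
    (hasFDerivAt_apply_apply hG.differentiableAt_christoffel.hasFDerivAt v.1 w.1) y
  have hgrad := hasFDerivAt_comp_fst (hdφ.smul (hG.differentiableAt_grad hφ)).hasFDerivAt y
  have hHvw := hasFDerivAt_comp_snd
    (hasFDerivAt_apply_apply hH.differentiableAt.hasFDerivAt v.2 w.2) x
  have hΓH := hasFDerivAt_comp_snd
    (hasFDerivAt_apply_apply hH.differentiableAt_christoffel.hasFDerivAt v.2 w.2) x
  have hθ' (a : E) := hasFDerivAt_comp_fst (hθ.hasFDerivAt.clm_apply (hasFDerivAt_const a x)) y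
  have hformula := ((hΓG.sub (hHvw.smul hgrad)).prodMk ((hΓH.add ((hθ' v.1).smul_const w.2)).add
    ((hθ' w.1).smul_const v.2))).congr_of_eventuallyEq
      (eventually_christoffel_warped hG hH hφ hφ₀ v w)
  have hΓW := hasFDerivAt_apply_apply
    (hG.warped hH hφ hφ₀).differentiableAt_christoffel.hasFDerivAt v w
  refine (DFunLike.congr_fun (hΓW.unique hformula) u).trans (Prod.ext ?_ ?_) <;> simp

theorem riemann_warped_fst_fst (hG : IsMetricAt G x) (hH : IsMetricAt H y)
    (hφ : ContDiffAt ℝ 2 φ x) (hφ₀ : φ x ≠ 0) (u v w : E) :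
    (riemann (warped G φ H) (x, y) (u, 0) (v, 0) (w, 0)).1 = riemann G x u v w := by
  simp [riemann_apply, fderiv_christoffel_warped hG hH hφ hφ₀, christoffel_warped hG hH hφ hφ₀]

theorem riemann_warped_snd_fst (hG : IsMetricAt G x) (hH : IsMetricAt H y)
    (hφ : ContDiffAt ℝ 2 φ x) (hφ₀ : φ x ≠ 0) (d : E') (v w : E) :
    (riemann (warped G φ H) (x, y) (0, d) (v, 0) (w, 0)).2 =
      -((φ x)⁻¹ * hess G φ x v w) • d := by
  simp only [riemann_apply, fderiv_christoffel_warped hG hH hφ hφ₀, map_zero, zero_apply, smul_zero,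
    zero_smul, add_zero, sub_self, fderiv_inv_smul_fderiv hφ hφ₀, zero_add, Prod.mk_sub_mk,
    zero_sub, christoffel_warped hG hH hφ hφ₀, sub_zero, smul_apply, smul_eq_mul, Prod.mk_add_mk,
    map_smul, hess_apply]
  module

theorem riemann_warped_fst_snd (hG : IsMetricAt G x) (hH : IsMetricAt H y)
    (hφ : ContDiffAt ℝ 2 φ x) (hφ₀ : φ x ≠ 0) (u : E) (a b : E') :
    (riemann (warped G φ H) (x, y) (u, 0) (0, a) (0, b)).1 =
      -(H y a b * φ x) • (G x).inverse (hess G φ x u) := by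
  have := FiniteDimensional.complete ℝ E
  have hsmul : fderiv ℝ (φ • grad G φ) x u =
      φ x • fderiv ℝ (grad G φ) x u + fderiv ℝ φ x u • grad G φ x := by
    rw [fderiv_smul (hφ.differentiableAt two_ne_zero) (hG.differentiableAt_grad hφ)]
    rfl
  simp only [riemann_apply, fderiv_christoffel_warped hG hH hφ hφ₀, map_zero, zero_apply, hsmul,
    hG.fderiv_grad hφ, zero_smul, add_zero, zero_sub, smul_zero, sub_self, Prod.mk_sub_mk, sub_zero,
    christoffel_warped hG hH hφ hφ₀, smul_apply, smul_eq_mul, map_neg, map_smul, zero_add,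
    Prod.mk_add_mk]
  match_scalars <;> field_simp <;> ring

theorem riemann_warped_snd_snd (hG : IsMetricAt G x) (hH : IsMetricAt H y)
    (hφ : ContDiffAt ℝ 2 φ x) (hφ₀ : φ x ≠ 0) (d a b : E') :
    (riemann (warped G φ H) (x, y) (0, d) (0, a) (0, b)).2 =
      riemann H y d a b - gradNormSq G φ x • wedge (H y) d a b := by
  simp only [riemann_apply, fderiv_christoffel_warped hG hH hφ hφ₀, map_zero, zero_apply, smul_zero,
    zero_add, zero_sub, zero_smul, add_zero, Prod.mk_sub_mk, sub_neg_eq_add,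
    christoffel_warped hG hH hφ hφ₀, smul_apply, smul_eq_mul, map_neg, map_smul, Prod.mk_add_mk,
    gradNormSq, wedge_apply]
  match_scalars <;> field_simp

theorem ricci_warped_fst (hG : IsMetricAt G x) (hH : IsMetricAt H y) (hφ : ContDiffAt ℝ 2 φ x)
    (hφ₀ : φ x ≠ 0) (v w : E) :
    ricci (warped G φ H) (x, y) (v, 0) (w, 0) =
      ricci G x v w - Module.finrank ℝ E' * ((φ x)⁻¹ * hess G φ x v w) := by
  let T := ((riemann (warped G φ H) (x, y)).flip (v, 0)).flip (w, 0)
  have hbase : LinearMap.fst ℝ E E' ∘ₗ (T : E × E' →ₗ[ℝ] E × E') ∘ₗ LinearMap.inl ℝ E E' =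
      (((riemann G x).flip v).flip w : E →L[ℝ] E) := by
    ext u
    exact riemann_warped_fst_fst hG hH hφ hφ₀ u v w
  have hfibre : LinearMap.snd ℝ E E' ∘ₗ (T : E × E' →ₗ[ℝ] E × E') ∘ₗ LinearMap.inr ℝ E E' =
      -((φ x)⁻¹ * hess G φ x v w) • LinearMap.id := by
    ext d
    exact riemann_warped_snd_fst hG hH hφ hφ₀ d v w
  rw [ricci_apply, trace_prod, hbase, hfibre, ricci_apply, map_smul, LinearMap.trace_id,
    smul_eq_mul]
  ring

theorem ricci_warped_snd (hG : IsMetricAt G x) (hH : IsMetricAt H y) (hφ : ContDiffAt ℝ 2 φ x)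
    (hφ₀ : φ x ≠ 0) (a b : E') :
    ricci (warped G φ H) (x, y) (0, a) (0, b) =
      ricci H y a b
        - (φ x * laplacian G φ x + (Module.finrank ℝ E' - 1) * gradNormSq G φ x) * H y a b := by
  let T := ((riemann (warped G φ H) (x, y)).flip (0, a)).flip (0, b)
  have hbase : LinearMap.fst ℝ E E' ∘ₗ (T : E × E' →ₗ[ℝ] E × E') ∘ₗ LinearMap.inl ℝ E E' =
      -(H y a b * φ x) • ((G x).inverse.comp (hess G φ x) : E →L[ℝ] E) := by
    ext u
    exact riemann_warped_fst_snd hG hH hφ hφ₀ u a b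
  have hfibre : LinearMap.snd ℝ E E' ∘ₗ (T : E × E' →ₗ[ℝ] E × E') ∘ₗ LinearMap.inr ℝ E E' =
      (((riemann H y).flip a).flip b : E' →L[ℝ] E')
        - gradNormSq G φ x • (((wedge (H y)).flip a).flip b : E' →L[ℝ] E') := by
    ext d
    exact riemann_warped_snd_snd hG hH hφ hφ₀ d a b
  rw [ricci_apply, trace_prod, hbase, hfibre, map_sub, map_smul, map_smul, ← ricci_apply,
    trace_wedge, smul_eq_mul, smul_eq_mul, laplacian]
  ring

end Warped

section RicciFlatWarped

variable {E : Type*} [NormedAddCommGroup E] [NormedSpace ℝ E] [FiniteDimensional ℝ E]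
  {E' : Type*} [NormedAddCommGroup E'] [NormedSpace ℝ E'] [FiniteDimensional ℝ E'] [Nontrivial E']
  {G : E → (E →L[ℝ] E →L[ℝ] ℝ)} {H : E' → (E' →L[ℝ] E' →L[ℝ] ℝ)} {φ : E → ℝ} {x : E} {y : E'}
  {c : ℝ}

theorem hess_eq_smul_of_ricci_warped_eq_zero (hE : Module.finrank ℝ E = 2) (hG : IsMetricAt G x)
    (hH : IsMetricAt H y) (hφ : ContDiffAt ℝ 2 φ x) (hφ₀ : φ x ≠ 0) (hc : scalar G x = c * φ x)
    (hW : ricci (warped G φ H) (x, y) = 0) :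
    hess G φ x = (c / (2 * Module.finrank ℝ E') * φ x ^ 2) • G x := by
  have hm : (Module.finrank ℝ E' : ℝ) ≠ 0 := Nat.cast_ne_zero.2 Module.finrank_pos.ne'
  ext v w
  have h := ricci_warped_fst hG hH hφ hφ₀ v w
  rw [hW, hG.ricci_eq_smul hE, hc] at h
  simp only [zero_apply, smul_apply, smul_eq_mul] at h ⊢
  field_simp at h ⊢
  linear_combination h

theorem ricci_eq_smul_of_ricci_warped_eq_zero (hE : Module.finrank ℝ E = 2) (hG : IsMetricAt G x)
    (hH : IsMetricAt H y) (hφ : ContDiffAt ℝ 2 φ x) (hφ₀ : φ x ≠ 0) (hc : scalar G x = c * φ x)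
    (hW : ricci (warped G φ H) (x, y) = 0) :
    ricci H y = (c / Module.finrank ℝ E' * φ x ^ 3
      + (Module.finrank ℝ E' - 1) * gradNormSq G φ x) • H y := by
  have hm : (Module.finrank ℝ E' : ℝ) ≠ 0 := Nat.cast_ne_zero.2 Module.finrank_pos.ne'
  have hlap := hG.laplacian_of_hess_eq_smul
    (hess_eq_smul_of_ricci_warped_eq_zero hE hG hH hφ hφ₀ hc hW)
  ext a b
  have h := ricci_warped_snd hG hH hφ hφ₀ a b
  rw [hW, hlap, hE] at h
  simp only [zero_apply, smul_apply, smul_eq_mul, Nat.cast_ofNat] at h ⊢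
  field_simp at h ⊢
  linear_combination -h

theorem fderiv_eq_zero_of_eventually_ricci_warped_eq_zero (hE : Module.finrank ℝ E = 2)
    (hG : IsMetricAt G x) (hH : IsMetricAt H y) (hφ : ContDiffAt ℝ 2 φ x) (hφ₀ : φ x ≠ 0)
    (hc : ∀ᶠ z in 𝓝 x, scalar G z = c * φ z)
    (hW : ∀ᶠ z in 𝓝 x, ricci (warped G φ H) (z, y) = 0) (hc₀ : c ≠ 0) : fderiv ℝ φ x = 0 := by
  have := FiniteDimensional.complete ℝ E
  set m : ℝ := (Module.finrank ℝ E' : ℝ)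
  have hm₀ : 0 < m := Nat.cast_pos.2 Module.finrank_pos
  let p : E → ℝ := fun z => c / m * φ z ^ 3 + (m - 1) * gradNormSq G φ z
  have hconst : p =ᶠ[𝓝 x] fun _ => p x := by
    have hricci : ∀ᶠ z in 𝓝 x, ricci H y = p z • H y := by
      filter_upwards [hG.eventually, hφ.eventually (by simp), hφ.continuousAt.eventually_ne hφ₀,
        hc, hW] with z hG hφ hφ₀ hc hW
      exact ricci_eq_smul_of_ricci_warped_eq_zero hE hG hH hφ hφ₀ hc hW
    filter_upwards [hricci] with z hz
    exact smul_left_injective ℝ hH.ne_zero (hz.symm.trans hricci.self_of_nhds)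
  have hhess := hess_eq_smul_of_ricci_warped_eq_zero hE hG hH hφ hφ₀ hc.self_of_nhds hW.self_of_nhds
  have hp := (((hφ.differentiableAt two_ne_zero).hasFDerivAt.pow 3).const_mul (c / m)).add
    ((hG.hasFDerivAt_gradNormSq_of_hess_eq_smul hφ hhess).const_mul (m - 1))
  have hzero := hp.unique ((hasFDerivAt_const (p x) x).congr_of_eventuallyEq hconst)
  have hsum : (c * (m + 2) / m * φ x ^ 2) • fderiv ℝ φ x = 0 := by
    rw [← hzero]
    module
  exact (smul_eq_zero.1 hsum).resolve_left (by positivity)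

theorem eq_zero_of_eventually_ricci_warped_eq_zero (hE : Module.finrank ℝ E = 2)
    (hG : IsMetricAt G x) (hH : IsMetricAt H y) (hφ : ContDiffAt ℝ 2 φ x) (hφ₀ : φ x ≠ 0)
    (hc : ∀ᶠ z in 𝓝 x, scalar G z = c * φ z)
    (hW : ∀ᶠ z in 𝓝 x, ricci (warped G φ H) (z, y) = 0) : c = 0 := by
  have := FiniteDimensional.complete ℝ E
  have : Nontrivial E := Module.nontrivial_of_finrank_pos (R := ℝ) (by lia)
  by_contra hc₀
  have hdφ : fderiv ℝ φ =ᶠ[𝓝 x] 0 := by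
    filter_upwards [hG.eventually, hφ.eventually (by simp), hφ.continuousAt.eventually_ne hφ₀,
      hc.eventually_nhds, hW.eventually_nhds] with z hG hφ hφ₀ hc hW
    exact fderiv_eq_zero_of_eventually_ricci_warped_eq_zero hE hG hH hφ hφ₀ hc hW hc₀
  have hhess := hess_eq_smul_of_ricci_warped_eq_zero hE hG hH hφ hφ₀ hc.self_of_nhds hW.self_of_nhds
  rw [hess_eq_zero_of_fderiv_eventuallyEq_zero hdφ, eq_comm, smul_eq_zero_iff_left hG.ne_zero]
    at hhess
  simp [hc₀, hφ₀, Module.finrank_pos.ne'] at hhess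

theorem riemann_eq_zero_and_hess_eq_zero (hE : Module.finrank ℝ E = 2)
    (hG : IsMetricAt G x) (hH : IsMetricAt H y) (hφ : ContDiffAt ℝ 2 φ x) (hφ₀ : φ x ≠ 0)
    (hc : ∀ᶠ z in 𝓝 x, scalar G z = c * φ z)
    (hW : ∀ᶠ z in 𝓝 x, ricci (warped G φ H) (z, y) = 0) : riemann G x = 0 ∧ hess G φ x = 0 := by
  have hc₀ := eq_zero_of_eventually_ricci_warped_eq_zero hE hG hH hφ hφ₀ hc hW
  refine ⟨hG.riemann_eq_zero_of_scalar_eq_zero hE ?_, ?_⟩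
  · rw [hc.self_of_nhds, hc₀, zero_mul]
  · rw [hess_eq_smul_of_ricci_warped_eq_zero hE hG hH hφ hφ₀ hc.self_of_nhds hW.self_of_nhds, hc₀]
    simp

end RicciFlatWarped

end LocalMetric

section Manifold

open LocalMetric

variable {E : Type*} [NormedAddCommGroup E] [NormedSpace ℝ E]
  {H : Type*} [TopologicalSpace H] {I : ModelWithCorners ℝ E H}
  {M : Type*} [TopologicalSpace M] [ChartedSpace H M]

section InChart

theorem extChartAt_symm_mem_chartAt_source {x₀ : M} {y : E} (hy : y ∈ (extChartAt I x₀).target) :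
    (extChartAt I x₀).symm y ∈ (chartAt H x₀).source :=
  extChartAt_source I x₀ ▸ (extChartAt I x₀).map_target hy

theorem symm_trivializationAt_extChartAt_symm [IsManifold I 1 M] {x₀ : M} {y : E}
    (hy : y ∈ (extChartAt I x₀).target) (u : E) :
    (trivializationAt E (TangentSpace I) x₀).symm ((extChartAt I x₀).symm y) u =
      mfderivWithin 𝓘(ℝ, E) I (extChartAt I x₀).symm (range I) y u := by
  have hmem := extChartAt_symm_mem_chartAt_source hy
  have hbase : (extChartAt I x₀).symm y ∈ (trivializationAt E (TangentSpace I) x₀).baseSet := by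
    simpa using hmem
  let D : E → E →L[ℝ] E := fun y' =>
    mfderivWithin 𝓘(ℝ, E) I (extChartAt I x₀).symm (range I) y'
  have hsymmL : ((trivializationAt E (TangentSpace I) x₀).symmL ℝ ((extChartAt I x₀).symm y) :
      E →L[ℝ] E) = D y :=
    (TangentBundle.symmL_trivializationAt hmem).trans
      (congrArg D ((extChartAt I x₀).right_inv hy))
  exact (Bundle.Trivialization.symmL_apply (R := ℝ) _ hbase _).symm.trans
    (DFunLike.congr_fun hsymmL u)

theorem PseudoRiemannianMetric.contDiffOn_inChart [IsManifold I ∞ M]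
    (g : PseudoRiemannianMetric I M) (x₀ : M) :
    ContDiffOn ℝ ∞ (g.val.inChart x₀) (extChartAt I x₀).target := by
  have : IsManifold I 1 M := IsManifold.of_le (n := ∞) (by simp)
  have hcoord := ((trivializationAt (E →L[ℝ] E →L[ℝ] ℝ)
    (fun x : M => TangentSpace I x →L[ℝ] TangentSpace I x →L[ℝ] ℝ)
    x₀).contMDiffOn_section_baseSet_iff (IB := I) (n := ∞) (s := g.val)).1 g.contMDiff.contMDiffOn
  have hsmooth := hcoord.comp (contMDiffOn_extChartAt_symm x₀) fun y hy => by
    simpa using extChartAt_symm_mem_chartAt_source hy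
  refine (contMDiffOn_iff_contDiffOn.1 hsmooth).congr fun y hy => ?_
  have hbase : (extChartAt I x₀).symm y ∈ (trivializationAt E (TangentSpace I) x₀).baseSet := by
    simpa using extChartAt_symm_mem_chartAt_source hy
  have htriv (x : M) (r : ℝ) :
      (trivializationAt ℝ (fun _ : M => ℝ) x₀).linearMapAt ℝ x r = r := by simp
  ext u v
  refine Eq.trans ?_ (inCoordinates_apply_eq₂ (E₃ := fun _ : M => ℝ) (F₃ := ℝ)
    hbase hbase (by simp)).symm
  rw [htriv]
  exact (congrArg₂ (fun a b => g.val ((extChartAt I x₀).symm y) a b)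
    (symm_trivializationAt_extChartAt_symm hy u)
    (symm_trivializationAt_extChartAt_symm hy v)).symm

theorem PseudoRiemannianMetric.isMetricAt_inChart [FiniteDimensional ℝ E] [I.Boundaryless]
    [IsManifold I ∞ M] (g : PseudoRiemannianMetric I M) {x₀ : M} {y : E}
    (hy : y ∈ (extChartAt I x₀).target) : IsMetricAt (g.val.inChart x₀) y where
  contDiffAt := ((g.contDiffOn_inChart x₀).contDiffAt
    ((isOpen_extChartAt_target x₀).mem_nhds hy)).of_le (by norm_cast)
  symm := .of_forall fun _ _ _ => g.symm _ _ _
  isInvertible := by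
    have : IsManifold I 1 M := IsManifold.of_le (n := ∞) (by simp)
    have hL := isInvertible_mfderivWithin_extChartAt_symm hy
    refine isInvertible_of_nondegenerate fun v hv => hL.injective ?_
    refine (g.nondegenerate _ _ fun w => ?_).trans (map_zero _).symm
    obtain ⟨w, rfl⟩ := hL.surjective w
    exact hv w

theorem contDiffOn_comp_extChartAt_symm {n : WithTop ℕ∞} [IsManifold I n M] {f : M → ℝ}
    (hf : ContMDiff I 𝓘(ℝ, ℝ) n f) (x₀ : M) :
    ContDiffOn ℝ n (f ∘ (extChartAt I x₀).symm) (extChartAt I x₀).target :=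
  contMDiffOn_iff_contDiffOn.1 (hf.comp_contMDiffOn (contMDiffOn_extChartAt_symm x₀))

end InChart

section WarpedProduct

variable {E' : Type*} [NormedAddCommGroup E'] [NormedSpace ℝ E']
  {H' : Type*} [TopologicalSpace H'] {J : ModelWithCorners ℝ E' H'}
  {F : Type*} [TopologicalSpace F] [ChartedSpace H' F] {x₀ : M} {y₀ : F} {z : E × E'}

theorem mem_extChartAt_prod_target : z ∈ (extChartAt (I.prod J) (x₀, y₀)).target ↔
    z.1 ∈ (extChartAt I x₀).target ∧ z.2 ∈ (extChartAt J y₀).target := by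
  rw [extChartAt_prod]
  exact Iff.rfl

variable [IsManifold I 1 M] [IsManifold J 1 F]

theorem mfderiv_fst_comp_mfderivWithin_extChartAt_symm
    (hz : z ∈ (extChartAt (I.prod J) (x₀, y₀)).target) :
    (mfderiv (I.prod J) I Prod.fst ((extChartAt (I.prod J) (x₀, y₀)).symm z)).comp
        (mfderivWithin 𝓘(ℝ, E × E') (I.prod J) (extChartAt (I.prod J) (x₀, y₀)).symm
          (range (I.prod J)) z) =
      (mfderivWithin 𝓘(ℝ, E) I (extChartAt I x₀).symm (range I) z.1).comp
        (ContinuousLinearMap.fst ℝ E E') := by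
  have hfst : HasMFDerivAt 𝓘(ℝ, E × E') 𝓘(ℝ, E) Prod.fst z (ContinuousLinearMap.fst ℝ E E') :=
    hasFDerivAt_fst.hasMFDerivAt
  have hrange : range (I.prod J) ⊆ Prod.fst ⁻¹' range I := by
    rintro _ ⟨p, rfl⟩
    exact ⟨p.1, rfl⟩
  exact ((I.prod J).uniqueMDiffOn _ (extChartAt_target_subset_range _ hz)).eq
    ((mdifferentiableAt_fst (I := I) (I' := J)).hasMFDerivAt.comp_hasMFDerivWithinAt z
      (mdifferentiableWithinAt_extChartAt_symm hz).hasMFDerivWithinAt)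
    ((mdifferentiableWithinAt_extChartAt_symm
      (mem_extChartAt_prod_target.1 hz).1).hasMFDerivWithinAt.comp z
        hfst.hasMFDerivWithinAt hrange)

theorem mfderiv_snd_comp_mfderivWithin_extChartAt_symm
    (hz : z ∈ (extChartAt (I.prod J) (x₀, y₀)).target) :
    (mfderiv (I.prod J) J Prod.snd ((extChartAt (I.prod J) (x₀, y₀)).symm z)).comp
        (mfderivWithin 𝓘(ℝ, E × E') (I.prod J) (extChartAt (I.prod J) (x₀, y₀)).symm
          (range (I.prod J)) z) =
      (mfderivWithin 𝓘(ℝ, E') J (extChartAt J y₀).symm (range J) z.2).comp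
        (ContinuousLinearMap.snd ℝ E E') := by
  have hsnd : HasMFDerivAt 𝓘(ℝ, E × E') 𝓘(ℝ, E') Prod.snd z (ContinuousLinearMap.snd ℝ E E') :=
    hasFDerivAt_snd.hasMFDerivAt
  have hrange : range (I.prod J) ⊆ Prod.snd ⁻¹' range J := by
    rintro _ ⟨p, rfl⟩
    exact ⟨p.2, rfl⟩
  exact ((I.prod J).uniqueMDiffOn _ (extChartAt_target_subset_range _ hz)).eq
    ((mdifferentiableAt_snd (I := I) (I' := J)).hasMFDerivAt.comp_hasMFDerivWithinAt z
      (mdifferentiableWithinAt_extChartAt_symm hz).hasMFDerivWithinAt)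
    ((mdifferentiableWithinAt_extChartAt_symm
      (mem_extChartAt_prod_target.1 hz).2).hasMFDerivWithinAt.comp z
        hsnd.hasMFDerivWithinAt hrange)

theorem warpedProduct_inChart (g : BilinField I M) (f : M → ℝ) (h : BilinField J F)
    (hz : z ∈ (extChartAt (I.prod J) (x₀, y₀)).target) :
    (warpedProduct g f h).inChart (x₀, y₀) z =
      warped (g.inChart x₀) (f ∘ (extChartAt I x₀).symm) (h.inChart y₀) z := by
  have hfst := DFunLike.congr_fun (mfderiv_fst_comp_mfderivWithin_extChartAt_symm hz)
  have hsnd := DFunLike.congr_fun (mfderiv_snd_comp_mfderivWithin_extChartAt_symm hz)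
  refine ContinuousLinearMap.ext fun u => ContinuousLinearMap.ext fun v => ?_
  exact congrArg₂ (· + ·)
    (congrArg₂ (fun a b => g ((extChartAt I x₀).symm z.1) a b) (hfst u) (hfst v))
    (congrArg (f ((extChartAt I x₀).symm z.1) ^ 2 * ·)
      (congrArg₂ (fun a b => h ((extChartAt J y₀).symm z.2) a b) (hsnd u) (hsnd v)))

end WarpedProduct

section Affine

theorem deriv_deriv_comp {φ : E → ℝ} {γ : ℝ → E} {t : ℝ} (hφ : ContDiffAt ℝ 2 φ (γ t))
    (hγ : ContDiffAt ℝ 2 γ t) :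
    deriv (deriv (φ ∘ γ)) t =
      fderiv ℝ (fderiv ℝ φ) (γ t) (deriv γ t) (deriv γ t)
        + fderiv ℝ φ (γ t) (deriv (deriv γ) t) := by
  have hderiv : deriv (φ ∘ γ) =ᶠ[𝓝 t] fun τ => fderiv ℝ φ (γ τ) (deriv γ τ) := by
    filter_upwards [hγ.eventually (by simp), hγ.continuousAt.eventually (hφ.eventually (by simp))]
      with τ hγ hφ
    exact fderiv_comp_deriv τ (hφ.differentiableAt two_ne_zero) (hγ.differentiableAt two_ne_zero)
  have hφ' := (differentiableAt_fderiv hφ).hasFDerivAt.comp_hasDerivAt t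
    (hγ.differentiableAt two_ne_zero).hasDerivAt
  have hγ' : HasDerivAt (deriv γ) (deriv (deriv γ) t) t :=
    (((hγ.fderiv_right (m := 1) le_rfl).clm_apply
      (contDiffAt_const (c := (1 : ℝ)))).differentiableAt one_ne_zero).hasDerivAt
  rw [hderiv.deriv_eq]
  exact (hφ'.clm_apply hγ').deriv

theorem exists_eq_mul_add_of_deriv_deriv_eq_zero {s : Set ℝ} (hs : IsOpen s)
    (hs' : IsPreconnected s) {p : ℝ → ℝ} (hp : ContDiffOn ℝ 2 p s)
    (h : ∀ t ∈ s, deriv (deriv p) t = 0) : ∃ a b : ℝ, ∀ t ∈ s, p t = a * t + b := by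
  obtain ⟨a, ha⟩ := hs.exists_is_const_of_deriv_eq_zero hs'
    ((hp.deriv_of_isOpen (m := 1) hs le_rfl).differentiableOn one_ne_zero) h
  have hderiv (t : ℝ) (ht : t ∈ s) : HasDerivAt (fun τ => p τ - a * τ) 0 t := by
    have hpt := ((hp.contDiffAt (hs.mem_nhds ht)).differentiableAt two_ne_zero).hasDerivAt
    have hsub := hpt.sub ((hasDerivAt_id t).const_mul a)
    rwa [ha t ht, mul_one, sub_self] at hsub
  obtain ⟨b, hb⟩ := hs.exists_is_const_of_deriv_eq_zero hs'
    (fun t ht => (hderiv t ht).differentiableAt.differentiableWithinAt)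
    (fun t ht => (hderiv t ht).deriv)
  exact ⟨a, b, fun t ht => by linarith [hb t ht]⟩

theorem isAffineFunction_of_hess_eq_zero [I.Boundaryless] [IsManifold I ∞ M] {g : BilinField I M}
    {f : M → ℝ} (hf : ContMDiff I 𝓘(ℝ, ℝ) ∞ f)
    (h : ∀ x₀ : M, ∀ y ∈ (extChartAt I x₀).target,
      hess (g.inChart x₀) (f ∘ (extChartAt I x₀).symm) y = 0) :
    IsAffineFunction g f := by
  intro γ s hs hs' ⟨hγ, hgeo⟩
  have hfγ : ContDiffOn ℝ ∞ (f ∘ γ) s := contMDiffOn_iff_contDiffOn.1 (hf.comp_contMDiffOn hγ)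
  refine exists_eq_mul_add_of_deriv_deriv_eq_zero hs hs'.isPreconnected
    (hfγ.of_le (by norm_cast)) fun t ht => ?_
  set e := extChartAt I (γ t)
  have hγt : ContMDiffAt 𝓘(ℝ, ℝ) I ∞ γ t := hγ.contMDiffAt (hs.mem_nhds ht)
  have hc : ContDiffAt ℝ ∞ (fun τ => e (γ τ)) t :=
    contMDiffAt_iff_contDiffAt.1 (ContMDiffAt.comp t contMDiffAt_extChartAt hγt)
  have hmem : e (γ t) ∈ e.target := mem_extChartAt_target _
  have hφ : ContDiffAt ℝ ∞ (f ∘ e.symm) (e (γ t)) :=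
    (contDiffOn_comp_extChartAt_symm hf (γ t)).contDiffAt
      ((isOpen_extChartAt_target (γ t)).mem_nhds hmem)
  have heq : f ∘ γ =ᶠ[𝓝 t] (f ∘ e.symm) ∘ fun τ => e (γ τ) := by
    filter_upwards [hγt.continuousAt.preimage_mem_nhds (extChartAt_source_mem_nhds (I := I) (γ t))]
      with τ hτ
    exact (congrArg f (e.left_inv hτ)).symm
  set u := deriv (fun τ => e (γ τ)) t
  have hhess : hess (g.inChart (γ t)) (f ∘ e.symm) (e (γ t)) u u = 0 := by
    rw [h (γ t) _ hmem]
    rfl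
  change deriv (deriv (f ∘ γ)) t = 0
  rw [heq.deriv.deriv_eq, deriv_deriv_comp (hφ.of_le (by norm_cast))
    (hc.of_le (by norm_cast)),
    eq_neg_of_add_eq_zero_left (hgeo (γ t) t ht (mem_extChartAt_source _)), map_neg,
    ← sub_eq_add_neg, ← hess_apply, hhess]

end Affine

end Manifold

theorem theorem2_general
    {E : Type*} [NormedAddCommGroup E] [NormedSpace ℝ E] [FiniteDimensional ℝ E]
    (hE : Module.finrank ℝ E = 2)
    {H : Type*} [TopologicalSpace H] {I : ModelWithCorners ℝ E H} [I.Boundaryless]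
    {B : Type*} [TopologicalSpace B] [ChartedSpace H B] [IsManifold I ∞ B]
    {E' : Type*} [NormedAddCommGroup E'] [NormedSpace ℝ E'] [FiniteDimensional ℝ E'] [Nontrivial E']
    {H' : Type*} [TopologicalSpace H'] {J : ModelWithCorners ℝ E' H'} [J.Boundaryless]
    {F : Type*} [TopologicalSpace F] [ChartedSpace H' F] [IsManifold J ∞ F] [Nonempty F]
    (g : PseudoRiemannianMetric I B) (h : PseudoRiemannianMetric J F)
    (f : B → ℝ) (hf : ContMDiff I 𝓘(ℝ, ℝ) ∞ f) (hf_ne : ∀ x, f x ≠ 0)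
    (c : ℝ) (hc : IsScalarCurvature g.val (fun x => c * f x))
    (hM : IsEinstein (warpedProduct g.val f h.val) 0) :
    IsFlat g.val ∧ IsAffineFunction g.val f := by
  have : IsManifold I 1 B := IsManifold.of_le (n := ∞) (by simp)
  have : IsManifold J 1 F := IsManifold.of_le (n := ∞) (by simp)
  obtain ⟨y₀⟩ := ‹Nonempty F›
  have hy := mem_extChartAt_target (I := J) y₀
  have key (x₀ : B) (x : E) (hx : x ∈ (extChartAt I x₀).target) :
      LocalMetric.riemann (g.val.inChart x₀) x = 0 ∧
        LocalMetric.hess (g.val.inChart x₀) (f ∘ (extChartAt I x₀).symm) x = 0 := by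
    have hnhds := (isOpen_extChartAt_target (I := I) x₀).mem_nhds hx
    refine LocalMetric.riemann_eq_zero_and_hess_eq_zero hE (g.isMetricAt_inChart hx)
      (h.isMetricAt_inChart hy) (((contDiffOn_comp_extChartAt_symm hf x₀).contDiffAt hnhds).of_le
        (by norm_cast)) (hf_ne _) (eventually_of_mem hnhds (hc x₀))
      (eventually_of_mem hnhds fun z hz => ?_)
    have hzy := (mem_extChartAt_prod_target (z := (z, _))).2 ⟨hz, hy⟩
    have hopen := (isOpen_extChartAt_target (I := I.prod J) (x₀, y₀)).mem_nhds hzy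
    rw [← LocalMetric.ricci_congr (eventuallyEq_of_mem hopen fun _ =>
      warpedProduct_inChart g.val f h.val), hM (x₀, y₀) _ hzy, zero_smul]
  exact ⟨fun x₀ x hx => (key x₀ x hx).1,
    isAffineFunction_of_hess_eq_zero hf fun x₀ x hx => (key x₀ x hx).2⟩

theorem theorem2
    {B : Type*} [TopologicalSpace B] [ChartedSpace (EuclideanSpace ℝ (Fin 2)) B]
    [IsManifold (𝓡 2) ∞ B]
    {F : Type*} [TopologicalSpace F] [ChartedSpace (EuclideanSpace ℝ (Fin 2)) F]
    [IsManifold (𝓡 2) ∞ F] [Nonempty F]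
    (g : PseudoRiemannianMetric (𝓡 2) B) (h : PseudoRiemannianMetric (𝓡 2) F)
    (f : B → ℝ) (hf : ContMDiff (𝓡 2) 𝓘(ℝ, ℝ) ∞ f) (hf_pos : ∀ x, 0 < f x)
    (c : ℝ) (hc : IsScalarCurvature g.val (fun x => c * f x))
    (μ : ℝ) (hμ : μ ≠ 0) (hF : IsEinstein h.val μ)
    (hM : IsEinstein (warpedProduct g.val f h.val) 0) :
    IsFlat g.val ∧ IsAffineFunction g.val f :=
  theorem2_general finrank_euclideanSpace_fin g h f hf (fun x => (hf_pos x).ne') c hc hM
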